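/- A tensor network $\mathcal N=(G,d,s,t)$ consists of a finite undirected (simple) graph $G=(V,E)$, an integer dimension $d_e\ge 2$ for each edge $e\in E$, and two distinct vertices $s$ (source) and $t$ (sink). For a vertex $v$ let $E(v)$ be the set of edges containing $v$, and put $V(S)=\bigotimes_{e\in E(s)}\mathbb C^{d_e}$ and $V(T)=\bigotimes_{e\in E(t)}\mathbb C^{d_e}$. A tensor assignment $\mathcal T$ chooses an arbitrary tensor $\mathcal T_u\in\bigotimes_{e\in E(u)}\mathbb C^{d_e}$ for every $u\in V\setminus\{s,t\}$. Contracting these tensors along the edges gives a linear map $\beta(\mathcal N;\mathcal T):V(S)\to V(T)$: in the standard product bases, its matrix entry at row $j$ and column $i$ is $$\sum_{x}\ \prod_{u\in V\setminus\{s,t\}}(\mathcal T_u)_{x|_{E(u)}},$$ where $x$ ranges over all labelings of $E$ with $x_e\in\{1,\dots,d_e\}$, $x|_{E(s)}=i$ and $x|_{E(t)}=j$ (so an edge joining $s$ and $t$ acts as the identity). The quantum max-flow $\widetilde{QMF}(\mathcal N)$ is the maximum of $\operatorname{rank}\beta(\mathcal N;\mathcal T)$ over all tensor assignments $\mathcal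 T$. A cut is a partition $V=\bar S\cup\bar T$ with $s\in\bar S$ and $t\in\bar T$; its value is the product of $d_e$ over all edges $e$ with one end in $\bar S$ and the other in $\bar T$ (the empty product being $1$). The quantum min-cut $QMC(\mathcal N)$ is the minimum value of a cut. For a positive integer $n$, $n\mathcal N$ denotes the network $(G,nd,s,t)$ in which every edge dimension is multiplied by $n$. **Theorem.** For every tensor network $\mathcal N=(G,d,s,t)$ there are infinitely many positive integers $n$ such that $$\widetilde{QMF}(n\mathcal N)=QMC(n\mathcal N).$$ -/

import Mathlib

open scoped TensorProduct

/-- A quantum tensor network `(G, d, s, t)` on the vertex type `V`: an undirected graph `G`,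
a dimension `d e ≥ 2` for each edge, and two distinct vertices, the source `s` and the sink `t`. -/
structure TensorNetwork (V : Type*) where
  G : SimpleGraph V
  d : G.edgeSet → ℕ
  two_le_d : ∀ e, 2 ≤ d e
  s : V
  t : V
  s_ne_t : s ≠ t

namespace TensorNetwork

variable {V : Type*}

/-- The network `nN`: every edge dimension is multiplied by `n ≥ 1`. -/
def scale (n : ℕ+) (N : TensorNetwork V) : TensorNetwork V where
  G := N.G
  d := fun e => n * N.d e
  two_le_d := fun e => (N.two_le_d e).trans (Nat.le_mul_of_pos_left _ n.pos)
  s := N.s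
  t := N.t
  s_ne_t := N.s_ne_t

/-- `E(v)`: the edges containing the vertex `v`. -/
abbrev EdgesAt (N : TensorNetwork V) (v : V) : Type _ :=
  {e : N.G.edgeSet // v ∈ (e : Sym2 V)}

/-- `⨂_{e ∈ E(v)} ℂ^{d_e}`, the tensor space at the vertex `v`. -/
abbrev Space (N : TensorNetwork V) (v : V) : Type _ :=
  ⨂[ℂ] e : N.EdgesAt v, (Fin (N.d e.1) → ℂ)

/-- Multi-indices at `v`: one value in `{0, …, d_e - 1}` for each edge `e` containing `v`. -/
abbrev Index (N : TensorNetwork V) (v : V) : Type _ :=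
  ∀ e : N.EdgesAt v, Fin (N.d e.1)

/-- One index value for each edge of the network. -/
abbrev Labeling (N : TensorNetwork V) : Type _ :=
  ∀ e : N.G.edgeSet, Fin (N.d e)

/-- The multi-index at `v` given by a labeling of all the edges. -/
def Labeling.at {N : TensorNetwork V} (x : N.Labeling) (v : V) : N.Index v :=
  fun e => x e.1

/-- The standard product basis of the tensor space at `v`. -/
noncomputable def stdBasis [Finite V] (N : TensorNetwork V) (v : V) :
    Module.Basis (N.Index v) ℂ (N.Space v) :=
  Basis.piTensorProduct fun e : N.EdgesAt v => Pi.basisFun ℂ (Fin (N.d e.1))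

/-- The vertices other than the source and the sink. -/
abbrev Inner (N : TensorNetwork V) : Type _ :=
  {u : V // u ≠ N.s ∧ u ≠ N.t}

/-- A tensor assignment: an arbitrary tensor at each vertex other than the source and the sink. -/
abbrev Assignment (N : TensorNetwork V) : Type _ :=
  ∀ u : N.Inner, N.Space u.1

open Classical in
/-- The matrix of the contracted network: the entry at `(j, i)` sums, over all the edge labelings
that restrict to `i` at the source and to `j` at the sink, the product of the corresponding entries
of the assigned tensors.  An edge joining the source and the sink thus acts as the identity. -/
noncomputable def contractionMatrix [Fintype V] (N : TensorNetwork V) (T : N.Assignment) :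
    Matrix (N.Index N.t) (N.Index N.s) ℂ :=
  fun j i => ∑ x : N.Labeling with x.at N.s = i ∧ x.at N.t = j,
    ∏ u : N.Inner, (N.stdBasis u.1).repr (T u) (x.at u.1)

open Classical in
/-- The linear map `V(S) → V(T)` obtained by contracting the tensors `T`. -/
noncomputable def contraction [Fintype V] (N : TensorNetwork V) (T : N.Assignment) :
    N.Space N.s →ₗ[ℂ] N.Space N.t :=
  Matrix.toLin (N.stdBasis N.s) (N.stdBasis N.t) (N.contractionMatrix T)

/-- The rank of the contracted map. -/
noncomputable def contractionRank [Fintype V] (N : TensorNetwork V) (T : N.Assignment) : ℕ :=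
  Module.finrank ℂ (LinearMap.range (N.contraction T))

/-- The quantum max-flow: the maximum rank over all tensor assignments. -/
noncomputable def maxFlow [Fintype V] (N : TensorNetwork V) : ℕ :=
  sSup (Set.range N.contractionRank)

/-- A cut is the partition of `V` into a set `A` and its complement, with the source in `A` and
the sink outside `A`. -/
def IsCut (N : TensorNetwork V) (A : Set V) : Prop :=
  N.s ∈ A ∧ N.t ∉ A

/-- The cut set: the edges with one end in `A` and the other end outside `A`. -/
def cutSet (N : TensorNetwork V) (A : Set V) : Set N.G.edgeSet :=
  {e | ∃ v ∈ A, ∃ w ∉ A, (e : Sym2 V) = s(v, w)}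

open Classical in
/-- The product of the dimensions of the edges in the cut set. -/
noncomputable def cutValue [Fintype V] (N : TensorNetwork V) (A : Set V) : ℕ :=
  ∏ e : N.G.edgeSet with e ∈ N.cutSet A, N.d e

/-- The quantum min-cut: the minimum of the cut values over all cuts. -/
noncomputable def minCut [Fintype V] (N : TensorNetwork V) : ℕ :=
  sInf (N.cutValue '' {A | N.IsCut A})

/-- The supremum defining the quantum max-flow is a maximum. -/
theorem maxFlow_isGreatest [Fintype V] (N : TensorNetwork V) :
    IsGreatest (Set.range N.contractionRank) N.maxFlow := by
  have hb : BddAbove (Set.range N.contractionRank) := by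
    classical
    have : Module.Finite ℂ (N.Space N.t) := Module.Finite.of_basis (N.stdBasis N.t)
    refine ⟨Module.finrank ℂ (N.Space N.t), ?_⟩
    rintro _ ⟨T, rfl⟩
    exact Submodule.finrank_le _
  exact ⟨Nat.sSup_mem ⟨_, fun _ => 0, rfl⟩ hb, fun _ h => le_csSup hb h⟩

/-- The infimum defining the quantum min-cut is a minimum. -/
theorem minCut_isLeast [Fintype V] (N : TensorNetwork V) :
    IsLeast (N.cutValue '' {A | N.IsCut A}) N.minCut :=
  ⟨Nat.sInf_mem ⟨_, {N.s}, ⟨rfl, fun h => N.s_ne_t h.symm⟩, rfl⟩, fun _ h => Nat.sInf_le h⟩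

end TensorNetwork

/-! The upper bound is the usual one: cutting the network along `A` factors the contraction through
the labels of the cut edges (`rank_contractionMatrix_le_cutValue`).

For the lower bound, treat dimensions as multiplicative capacities. For large `n` the dimension `n *
d` behaves like the element `(1, d)` of `ℤ × ℚ>0` under the lexicographic order. Max-flow min-cut
holds over every linearly ordered abelian group (`exists_flow_of_cut_condition`), so a
lexicographically minimal cut `A`, independent of `n`, carries a flow of equal value. Evaluating
`(a, q)` as `n ^ a * q` gives a rational multiplicative flow whose value is the integer `cutValue A`
of `nN`.

Each `p`-adic valuation of this flow is an integral additive flow. Peeling off unit flows one prime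
at a time yields connecting sets with prime weights; the weights using an edge multiply to at most
numerator times denominator of its flow value (`exists_weighted_connecting_family`). If `n` is
divisible by all these products for the components `q`, they fit into `n * d`
(`ratWeight_lexEval_le`). Independent messages can then be sent along the connecting sets, and the
rank reaches the product of the weights (`prod_le_maxFlow`). -/

/-! ### Max-flow min-cut over ordered abelian groups -/

/-- The sign with which an arc from `v` to `w` crosses `A`: `1` if it leaves `A`, `-1` if it
enters `A`, and `0` otherwise. -/
noncomputable def cutSign {V : Type*} (A : Set V) (v w : V) : ℤ :=
  A.indicator 1 v - A.indicator 1 w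

open Classical in
/-- The largest net amount that an arc from `v` to `w` can carry out of `A` if its flow is bounded
below by `l` and above by `u`. -/
noncomputable def outCapacity {V Γ : Type*} [AddGroup Γ] (l u : Γ) (A : Set V) (v w : V) : Γ :=
  if v ∈ A then if w ∈ A then 0 else u else if w ∈ A then -l else 0

section Flow

variable {V E Γ : Type*} [AddCommGroup Γ] [LinearOrder Γ] [IsOrderedAddMonoid Γ]

/-- Submodularity, needed for uncrossing. The two sides differ only for an arc between `A \ B` and
`B \ A`, and then by the slack `u - l`. -/
theorem outCapacity_inter_add_union_le {l u : Γ} (h : l ≤ u) (A B : Set V) (v w : V) :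
    outCapacity l u (A ∩ B) v w + outCapacity l u (A ∪ B) v w ≤
      outCapacity l u A v w + outCapacity l u B v w := by
  have h' : 0 ≤ u + -l := by rw [← sub_eq_add_neg]; exact sub_nonneg.2 h
  by_cases h1 : v ∈ A <;> by_cases h2 : w ∈ A <;> by_cases h3 : v ∈ B <;> by_cases h4 : w ∈ B <;>
    simp [outCapacity, h1, h2, h3, h4, h, add_comm]

theorem cutSign_modular (A B : Set V) (v w : V) :
    cutSign (A ∩ B) v w + cutSign (A ∪ B) v w = cutSign A v w + cutSign B v w := by
  by_cases h1 : v ∈ A <;> by_cases h2 : w ∈ A <;> by_cases h3 : v ∈ B <;>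
    by_cases h4 : w ∈ B <;> simp [cutSign, h1, h2, h3, h4]

/-- A feasible flow with prescribed net outflows exists if no set violates the cut condition
(over an arbitrary linearly ordered abelian group). -/
theorem exists_flow_of_cut_condition [Finite V] (src tgt : E → V) (l u : E → Γ)
    (hlu : ∀ e, l e ≤ u e) (S : Finset E) : ∀ (b : Set V → Γ), b ∅ = 0 → b Set.univ = 0 →
    (∀ A B, b (A ∩ B) + b (A ∪ B) = b A + b B) →
    (∀ A, b A ≤ ∑ e ∈ S, outCapacity (l e) (u e) A (src e) (tgt e)) →
    ∃ f : E → Γ, (∀ e, l e ≤ f e ∧ f e ≤ u e) ∧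
      ∀ A, ∑ e ∈ S, cutSign A (src e) (tgt e) • f e = b A := by
  classical
  induction S using Finset.induction_on with
  | empty =>
    intro b h0 h1 hm hb
    refine ⟨l, fun e => ⟨le_rfl, hlu e⟩, fun A => ?_⟩
    -- `b A` and `b Aᶜ` are both at most zero and sum to zero.
    have h2 := hm A Aᶜ
    rw [Set.inter_compl_self, Set.union_compl_self, h0, h1, add_zero] at h2
    have h3 := hb A
    have h4 := hb Aᶜ
    simp only [Finset.sum_empty] at h3 h4 ⊢
    refine le_antisymm ?_ h3
    rw [eq_neg_of_add_eq_zero_left h2.symm]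
    simpa using h4
  | insert e S he ih =>
    intro b h0 h1 hm hb
    simp only [Finset.sum_insert he] at hb ⊢
    set c : Set V → Γ := fun A => ∑ e ∈ S, outCapacity (l e) (u e) A (src e) (tgt e) with hc
    have hsub : ∀ A B, c (A ∩ B) + c (A ∪ B) ≤ c A + c B := fun A B => by
      simp only [hc, ← Finset.sum_add_distrib]
      exact Finset.sum_le_sum fun e _ => outCapacity_inter_add_union_le (hlu e) A B _ _
    replace hb : ∀ A, b A ≤ outCapacity (l e) (u e) A (src e) (tgt e) + c A := hb
    obtain ⟨x, hx1, hx2, hx3, hx4⟩ : ∃ x, l e ≤ x ∧ x ≤ u e ∧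
        (∀ A, src e ∈ A → tgt e ∉ A → b A - c A ≤ x) ∧
        (∀ B, src e ∉ B → tgt e ∈ B → x ≤ c B - b B) := by
      -- The flow on `e` is the greatest of its finitely many lower bounds; it remains to see that
      -- each lower bound is below each upper bound.
      obtain ⟨x, hx, hmax⟩ := Set.exists_max_image
        (insert (l e) ((fun A => b A - c A) '' {A | src e ∈ A ∧ tgt e ∉ A})) id
        (Set.toFinite _) ⟨_, Set.mem_insert _ _⟩
      refine ⟨x, hmax _ (Set.mem_insert _ _), ?_, fun A h h' =>
        hmax _ (Set.mem_insert_of_mem _ ⟨A, ⟨h, h'⟩, rfl⟩), fun B h h' => ?_⟩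
      · rcases hx with rfl | ⟨A, ⟨h, h'⟩, rfl⟩
        · exact hlu e
        · have := hb A
          simp only [outCapacity, h, h', if_true, if_false] at this
          exact sub_le_iff_le_add.2 this
      · rcases hx with rfl | ⟨A, ⟨hA, hA'⟩, rfl⟩
        · have := hb B
          simp only [outCapacity, h, h', if_true, if_false] at this
          rw [le_sub_iff_add_le, ← sub_nonneg]
          rw [← sub_nonneg] at this
          convert this using 1
          abel
        -- Uncrossing: `e` leaves `A` and enters `B`, so it crosses neither `A ∩ B` nor `A ∪ B`, and
        -- its capacity drops out of both cut conditions.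
        · have h2 := hb (A ∩ B)
          have h3 := hb (A ∪ B)
          simp only [outCapacity, Set.mem_inter_iff, Set.mem_union, h, h', hA, hA', and_false,
            and_true, or_true, if_true, if_false, zero_add, or_false] at h2 h3
          have h4 := (hm A B) ▸ (add_le_add h2 h3).trans (hsub A B)
          simp only
          rw [sub_le_sub_iff]
          rw [add_comm (c B)]
          exact h4
    obtain ⟨f, hf1, hf2⟩ := ih (fun A => b A - cutSign A (src e) (tgt e) • x)
      (by simp [cutSign, h0]) (by simp [cutSign, h1])
      (fun A B => by
        rw [sub_add_sub_comm, hm, ← add_smul, cutSign_modular, add_smul, sub_add_sub_comm])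
      (fun A => by
        have h2 := hb A
        by_cases h : src e ∈ A <;> by_cases h' : tgt e ∈ A <;>
          simp only [outCapacity, cutSign, h, h', if_true, if_false, Set.indicator_of_mem,
            Set.indicator_of_notMem, not_false_eq_true, zero_add, Pi.one_apply, sub_self,
            zero_smul, sub_zero, one_smul, zero_sub, neg_smul, sub_neg_eq_add] at h2 ⊢
        · exact h2
        · exact sub_le_comm.1 (hx3 A h h')
        · have := hx4 A h h'
          rw [le_sub_iff_add_le, add_comm] at this
          exact this
        · exact h2)
    refine ⟨Function.update f e x, fun e' => ?_, fun A => ?_⟩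
    · by_cases h : e' = e
      · subst h; simp [hx1, hx2]
      · simp [h, hf1]
    · rw [Finset.sum_congr rfl (g := fun e => cutSign A (src e) (tgt e) • f e), hf2]
      · simp
      · intro e' he'
        rw [Function.update_of_ne]
        rintro rfl
        exact he he'

theorem outCapacity_nonneg {l u : Γ} (hl : l ≤ 0) (hu : 0 ≤ u) (A : Set V) (v w : V) :
    0 ≤ outCapacity l u A v w := by
  unfold outCapacity
  split_ifs <;> simp [hl, hu]

/-- Max-flow min-cut, over an arbitrary linearly ordered abelian group. -/
theorem exists_flow_of_le_cuts [Finite V] [Fintype E] (src tgt : E → V) (s t : V) (l u : E → Γ)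
    (hl : ∀ e, l e ≤ 0) (hu : ∀ e, 0 ≤ u e) (val : Γ) (hval : 0 ≤ val)
    (hcut : ∀ A : Set V, s ∈ A → t ∉ A →
      val ≤ ∑ e, outCapacity (l e) (u e) A (src e) (tgt e)) :
    ∃ f : E → Γ, (∀ e, l e ≤ f e ∧ f e ≤ u e) ∧
      ∀ A, ∑ e, cutSign A (src e) (tgt e) • f e = cutSign A s t • val := by
  refine exists_flow_of_cut_condition src tgt l u (fun e => (hl e).trans (hu e)) Finset.univ
    (fun A => cutSign A s t • val) (by simp [cutSign]) (by simp [cutSign])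
    (fun A B => by rw [← add_smul, cutSign_modular, add_smul]) (fun A => ?_)
  have h0 : 0 ≤ ∑ e, outCapacity (l e) (u e) A (src e) (tgt e) :=
    Finset.sum_nonneg fun e _ => outCapacity_nonneg (hl e) (hu e) A _ _
  by_cases hs : s ∈ A <;> by_cases ht : t ∈ A
  · simpa [cutSign, hs, ht] using h0
  · simpa [cutSign, hs, ht] using hcut A hs ht
  · simpa [cutSign, hs, ht] using (neg_nonpos.2 hval).trans h0
  · simpa [cutSign, hs, ht] using h0

/-- An integral flow of positive value dominates a flow of value one. -/
theorem exists_unit_flow [Finite V] [Fintype E] (src tgt : E → V) (s t : V) (F : E → ℤ) (m : ℤ)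
    (hm : 0 < m) (hF : ∀ A, ∑ e, cutSign A (src e) (tgt e) • F e = cutSign A s t • m) :
    ∃ g : E → ℤ, (∀ e, g e = 0 ∨ g e = 1 ∧ 0 < F e ∨ g e = -1 ∧ F e < 0) ∧
      ∀ A, ∑ e, cutSign A (src e) (tgt e) • g e = cutSign A s t := by
  obtain ⟨g, hg, hg'⟩ := exists_flow_of_le_cuts src tgt s t
    (fun e => if F e < 0 then -1 else 0) (fun e => if 0 < F e then 1 else 0)
    (fun e => by split_ifs <;> simp) (fun e => by split_ifs <;> simp)
    1 zero_le_one (fun A hs ht => by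
      have h0 := hF A
      have h1 : cutSign A s t = 1 := by simp [cutSign, hs, ht]
      rw [h1, one_smul] at h0
      -- The net flow `m` out of `A` is positive, so some arc carries a positive amount out; its
      -- truncated capacity is already `1`.
      obtain ⟨e, -, he⟩ := Finset.exists_lt_of_sum_lt (s := Finset.univ) (f := fun _ : E => (0 : ℤ))
        (g := fun e => cutSign A (src e) (tgt e) • F e) (by rw [h0]; simpa using hm)
      refine le_trans ?_ (Finset.single_le_sum (fun e _ => outCapacity_nonneg ?_ ?_ A _ _)
        (Finset.mem_univ e))
      · by_cases h : src e ∈ A <;> by_cases h' : tgt e ∈ A <;>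
          simp [cutSign, outCapacity, h, h'] at he ⊢ <;> simp [he]
      · split_ifs <;> simp
      · split_ifs <;> simp)
  refine ⟨g, fun e => ?_, fun A => by simpa using hg' A⟩
  have := hg e
  split_ifs at this <;> omega

end Flow

/-! ### Decomposing rational multiplicative flows -/

/-- A set of arcs is connecting if it crosses every cut that separates `s` from `t`. -/
def IsConnecting {V E : Type*} (src tgt : E → V) (s t : V) (C : Set E) : Prop :=
  ∀ A : Set V, s ∈ A → t ∉ A → ∃ e ∈ C, ¬(src e ∈ A ↔ tgt e ∈ A)

/-- A separating set crossed by no arc of the support would have net outflow `0` instead of `1`. -/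
theorem isConnecting_of_flow {V E : Type*} [Fintype E] (src tgt : E → V) (s t : V) (g : E → ℤ)
    (hg : ∀ A, ∑ e, cutSign A (src e) (tgt e) • g e = cutSign A s t) :
    IsConnecting src tgt s t {e | g e ≠ 0} := by
  intro A hs ht
  by_contra! h
  have h1 := hg A
  rw [Finset.sum_eq_zero] at h1
  · simp [cutSign, hs, ht] at h1
  · intro e _
    by_cases h2 : g e = 0
    · simp [h2]
    · have := h e h2
      by_cases h3 : src e ∈ A <;> simp_all [cutSign]

/-- The product of the numerator and the denominator of a rational number. -/
def ratWeight (q : ℚ) : ℕ := q.num.natAbs * q.den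

theorem ratWeight_inv (q : ℚ) : ratWeight q⁻¹ = ratWeight q := by
  rcases eq_or_ne q 0 with rfl | h
  · simp
  · have : q.num ≠ 0 := Rat.num_ne_zero.2 h
    simp only [ratWeight, Rat.num_inv, Rat.den_inv_of_ne_zero h, Int.natAbs_mul, Int.natAbs_natCast,
      Int.natAbs_sign_of_ne_zero this, one_mul]
    rw [mul_comm]

/-- The prime divides the numerator, and cancelling it there leaves the fraction reduced. -/
theorem mul_ratWeight_div {p : ℕ} [hp : Fact p.Prime] {q : ℚ} (h : 0 < padicValRat p q) :
    p * ratWeight (q / p) = ratWeight q := by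
  have hq : q ≠ 0 := by rintro rfl; simp at h
  have h1 : (p : ℤ) ∣ q.num := by
    by_contra h1
    rw [padicValRat_def, padicValInt.eq_zero_of_not_dvd h1] at h
    omega
  obtain ⟨k, hk⟩ := h1
  have h2 : q / p = (k : ℚ) / (q.den : ℤ) := by
    have : (p : ℚ) ≠ 0 := by exact_mod_cast hp.out.ne_zero
    conv_lhs => rw [← Rat.num_div_den q, hk]
    push_cast
    field_simp
  have hco : Nat.Coprime k.natAbs (q.den : ℤ).natAbs := by
    have := q.reduced
    rw [hk, Int.natAbs_mul] at this
    exact Nat.Coprime.coprime_mul_left this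
  have hpos : (0 : ℤ) < q.den := by exact_mod_cast q.den_pos
  have h3 : (q / p).num = k := by rw [h2]; exact Rat.num_div_eq_of_coprime hpos hco
  have h4 : ((q / p).den : ℤ) = q.den := by rw [h2]; exact Rat.den_div_eq_of_coprime hpos hco
  rw [ratWeight, ratWeight, h3, Int.natCast_inj.1 h4, hk, Int.natAbs_mul, Int.natAbs_natCast,
    mul_assoc]

theorem ratWeight_pos {q : ℚ} (h : 0 < q) : 0 < ratWeight q :=
  Nat.mul_pos (Int.natAbs_pos.2 (Rat.num_ne_zero.2 h.ne')) q.den_pos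

open Classical in
/-- A multiplicative flow with rational values whose total value is a positive integer decomposes
into weighted connecting sets. -/
theorem exists_weighted_connecting_family {V E : Type*} [Finite V] [Fintype E] (src tgt : E → V)
    (s t : V) (n : ℕ) : ∀ r : E → ℚ, 0 < n → (∀ e, 0 < r e) →
      (∀ A, ∏ e, r e ^ cutSign A (src e) (tgt e) = (n : ℚ) ^ cutSign A s t) →
    ∃ (ι : Type) (_ : Fintype ι) (m : ι → ℕ) (C : ι → Set E), ∏ i, m i = n ∧
      (∀ i, IsConnecting src tgt s t (C i)) ∧
      ∀ e, (∏ i, if e ∈ C i then m i else 1) ≤ ratWeight (r e) := by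
  induction n using Nat.strong_induction_on with
  | _ n ih =>
  intro r hn hr hflow
  rcases (Nat.one_le_iff_ne_zero.2 hn.ne').eq_or_lt with rfl | h1
  · exact ⟨Empty, inferInstance, Empty.elim, Empty.elim, by simp, fun i => i.elim,
      fun e => by
        rw [Finset.univ_eq_empty, Finset.prod_empty]
        exact ratWeight_pos (hr e)⟩
  obtain ⟨p, hp, k, rfl⟩ := Nat.exists_prime_and_dvd h1.ne'
  have := Fact.mk hp
  have hk : 0 < k := Nat.pos_of_mul_pos_left hn
  have hpQ : (0 : ℚ) < p := by exact_mod_cast hp.pos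
  have hval : 0 < padicValRat p ((p * k : ℕ) : ℚ) := by
    rw [padicValRat.of_nat]
    exact_mod_cast one_le_padicValNat_of_dvd hn.ne' (dvd_mul_right p k)
  -- The valuations at `p` form an additive flow of positive value.
  obtain ⟨g, hg, hg'⟩ := exists_unit_flow src tgt s t (fun e => padicValRat p (r e)) _ hval
    (fun A => by
      have h2 := congrArg (padicValRat p) (hflow A)
      rw [padicValRat.zpow] at h2
      rw [smul_eq_mul, ← h2]
      symm
      clear h2 hflow ih
      induction (Finset.univ : Finset E) using Finset.induction_on with
      | empty => simp
      | insert e S he ih =>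
        rw [Finset.prod_insert he, Finset.sum_insert he, padicValRat.mul
          (zpow_ne_zero _ (hr e).ne') (Finset.prod_ne_zero_iff.2 fun e _ =>
            zpow_ne_zero _ (hr e).ne'), ih, padicValRat.zpow, smul_eq_mul])
  obtain ⟨ι, _, m, C, hm, hC, hle⟩ := ih k (by nlinarith [hp.two_le])
    (fun e => r e / (p : ℚ) ^ g e) hk (fun e => div_pos (hr e) (zpow_pos hpQ _))
    (fun A => by
      simp only [div_zpow, Finset.prod_div_distrib, hflow]
      rw [div_eq_iff (Finset.prod_ne_zero_iff.2 fun e _ =>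
        zpow_ne_zero _ (zpow_ne_zero _ hpQ.ne')), Nat.cast_mul, mul_zpow, mul_comm]
      congr 1
      rw [← hg' A]
      clear hflow hg' hg
      induction (Finset.univ : Finset E) using Finset.induction_on with
      | empty => simp
      | insert e S he ih =>
        rw [Finset.prod_insert he, Finset.sum_insert he, zpow_add₀ hpQ.ne', ih, ← zpow_mul,
          smul_eq_mul, mul_comm (g e)])
  obtain ⟨D, hD⟩ : ∃ D : Set E, D = {e | g e ≠ 0} := ⟨_, rfl⟩
  have hmem : ∀ e, e ∈ D ↔ g e ≠ 0 := fun e => by rw [hD]; rfl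
  refine ⟨Option ι, inferInstance, fun i => i.elim p m, fun i => i.elim D C,
    by simp [Fintype.prod_option, hm], fun i => ?_, fun e => ?_⟩
  · cases i with
    | none => exact hD ▸ isConnecting_of_flow src tgt s t g hg'
    | some i => exact hC i
  · rw [Fintype.prod_option]
    have h2 := hle e
    change (if e ∈ D then p else 1) * (∏ i, if e ∈ C i then m i else 1) ≤ _
    -- The sign of `g e` agrees with that of the valuation, so dividing by `p ^ g e` cancels a `p`
    -- from the numerator or the denominator, which pays for the new weight `p`.
    rcases hg e with h0 | ⟨h0, h3⟩ | ⟨h0, h3⟩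
    · simpa [hmem, h0] using h2
    · rw [if_pos ((hmem e).2 (by simp [h0])), ← mul_ratWeight_div h3]
      simp only [h0, zpow_one] at h2
      exact Nat.mul_le_mul_left _ h2
    · rw [if_pos ((hmem e).2 (by simp [h0])), ← ratWeight_inv, ← mul_ratWeight_div (p := p)
        (by rw [padicValRat.inv]; omega), ← ratWeight_inv]
      simp only [h0, zpow_neg, zpow_one] at h2
      refine Nat.mul_le_mul_left _ (h2.trans (le_of_eq ?_))
      congr 1
      field_simp

/-! ### Rank bounds for contractions -/

namespace TensorNetwork

variable {V : Type*}

/-- A set of edges is linking if it meets every cut. -/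
def IsLinking (N : TensorNetwork V) (C : Set N.G.edgeSet) : Prop :=
  ∀ A : Set V, N.IsCut A → ∃ e ∈ C, e ∈ N.cutSet A

open Classical in
theorem contractionRank_eq_rank [Fintype V] (N : TensorNetwork V) (T : N.Assignment) :
    N.contractionRank T = (N.contractionMatrix T).rank := by
  exact (Matrix.rank_eq_finrank_range_toLin _ _ _).symm

/-- A common encoding of the values of the linking sets in the edge spaces. -/
theorem exists_edge_code (N : TensorNetwork V) {ι : Type*} [Fintype ι] (m : ι → ℕ)
    (C : ι → Set N.G.edgeSet) (e : N.G.edgeSet)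
    (h : (∏ i, open Classical in if e ∈ C i then m i else 1) ≤ N.d e) :
    ∃ c : (∀ i, Fin (m i)) → Fin (N.d e), ∀ w w', c w = c w' → ∀ i, e ∈ C i → w i = w' i := by
  classical
  obtain ⟨f⟩ := Function.Embedding.nonempty_of_card_le
    (α := ∀ i : {i // e ∈ C i}, Fin (m i.1)) (β := Fin (N.d e)) (by
      rw [Fintype.card_pi, Fintype.card_fin]
      refine le_trans (le_of_eq ?_) h
      simp only [Fintype.card_fin]
      rw [← Finset.prod_filter]
      exact (Finset.prod_subtype (p := fun i => e ∈ C i) _ (by simp) m).symm)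
  refine ⟨fun w => f fun i => w i.1, fun w w' hw i hi => ?_⟩
  exact congrFun (f.injective hw) ⟨i, hi⟩

open Classical in
/-- A family of linking sets with weights fitting into the edge dimensions bounds the quantum
max-flow from below. -/
theorem prod_le_maxFlow [Fintype V] (N : TensorNetwork V) {ι : Type*} [Fintype ι] (m : ι → ℕ)
    (C : ι → Set N.G.edgeSet) (hC : ∀ i, N.IsLinking (C i))
    (h : ∀ e, (∏ i, open Classical in if e ∈ C i then m i else 1) ≤ N.d e) :
    ∏ i, m i ≤ N.maxFlow := by
  choose code hcode using fun e => N.exists_edge_code m C e (h e)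
  let lab : (∀ i, Fin (m i)) → N.Labeling := fun w e => code e w
  -- Each tensor is the indicator of the local restrictions of the codewords `lab w`.
  let T : N.Assignment := fun u => (N.stdBasis u.1).equivFun.symm
    fun z => if ∃ w, (lab w).at u.1 = z then 1 else 0
  have hT : ∀ (u : N.Inner) (z), (N.stdBasis u.1).repr (T u) z =
      if ∃ w, (lab w).at u.1 = z then 1 else 0 := fun u z => by
    rw [← Module.Basis.equivFun_apply, LinearEquiv.apply_symm_apply]
  have hprod : ∀ x : N.Labeling, ∏ u : N.Inner, (N.stdBasis u.1).repr (T u) (x.at u.1) =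
      if ∀ u : N.Inner, ∃ w, (lab w).at u.1 = x.at u.1 then (1 : ℂ) else 0 := fun x => by
    simp only [hT]
    rw [Finset.prod_ite_zero]
    simp
  have hM : ∀ w w', N.contractionMatrix T ((lab w').at N.t) ((lab w).at N.s) =
      ((Finset.univ.filter fun x : N.Labeling => (x.at N.s = (lab w).at N.s ∧
        x.at N.t = (lab w').at N.t) ∧
        ∀ u : N.Inner, ∃ w, (lab w).at u.1 = x.at u.1).card : ℂ) := fun w w' => by
    simp only [contractionMatrix, hprod]
    rw [Finset.sum_boole, Finset.filter_filter]
  have hne : ∀ w w' (x : N.Labeling), x.at N.s = (lab w).at N.s → x.at N.t = (lab w').at N.t →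
      (∀ u : N.Inner, ∃ w, (lab w).at u.1 = x.at u.1) → w = w' := fun w w' x hs ht hu => by
    have hv : ∀ v, ∃ y, (lab y).at v = x.at v ∧ (v = N.s → y = w) ∧ (v = N.t → y = w') := by
      intro v
      by_cases h1 : v = N.s
      · subst h1
        exact ⟨w, hs.symm, fun _ => rfl, fun h => absurd h N.s_ne_t⟩
      by_cases h2 : v = N.t
      · subst h2
        exact ⟨w', ht.symm, fun h => absurd h h1, fun _ => rfl⟩
      obtain ⟨y, hy⟩ := hu ⟨v, h1, h2⟩
      exact ⟨y, hy, fun h => absurd h h1, fun h => absurd h h2⟩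
    choose y hy hys hyt using hv
    funext i
    rw [← hys _ rfl, ← hyt _ rfl]
    by_contra hne
    -- If `w i ≠ w' i`, the vertices that agree with the source on message `i` form a cut. An edge
    -- of `C i` crosses it, but its label determines message `i`, so its two ends agree.
    obtain ⟨e, he, a, ha, b, hb, hab⟩ := hC i {v | y v i = y N.s i} ⟨rfl, fun h => hne h.symm⟩
    have h1 := congrFun (hy a) ⟨e, by rw [hab]; exact Sym2.mem_mk_left _ _⟩
    have h2 := congrFun (hy b) ⟨e, by rw [hab]; exact Sym2.mem_mk_right _ _⟩
    have h3 : y b i = y a i := hcode e _ _ (h2.trans h1.symm) i he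
    exact hb (h3.trans ha)
  have hdiag : (N.contractionMatrix T).submatrix (fun w => (lab w).at N.t)
      (fun w => (lab w).at N.s) = Matrix.diagonal fun w =>
        N.contractionMatrix T ((lab w).at N.t) ((lab w).at N.s) := by
    ext w' w
    rw [Matrix.submatrix_apply]
    by_cases hw : w' = w
    · subst hw; simp
    · rw [Matrix.diagonal_apply_ne _ hw, hM]
      rw [Nat.cast_eq_zero, Finset.card_eq_zero, Finset.filter_eq_empty_iff]
      rintro x - ⟨⟨h1, h2⟩, h3⟩
      exact hw (hne w w' x h1 h2 h3).symm
  calc ∏ i, m i = Fintype.card (∀ i, Fin (m i)) := by simp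
    _ = ((N.contractionMatrix T).submatrix (fun w => (lab w).at N.t)
          (fun w => (lab w).at N.s)).rank := by
        rw [hdiag, Matrix.rank_diagonal]
        refine (Fintype.card_congr (Equiv.subtypeUnivEquiv fun w => ?_)).symm
        rw [hM, Nat.cast_ne_zero]
        refine Finset.card_ne_zero_of_mem (a := lab w) ?_
        simp
    _ ≤ (N.contractionMatrix T).rank := Matrix.rank_submatrix_le _ _ _
    _ = N.contractionRank T := (N.contractionRank_eq_rank T).symm
    _ ≤ N.maxFlow := N.maxFlow_isGreatest.2 ⟨T, rfl⟩

open Classical in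
/-- The contraction factors through the labels of the edges of a cut, which bounds its rank. -/
theorem rank_contractionMatrix_le_cutValue [Fintype V] (N : TensorNetwork V) (T : N.Assignment)
    (A : Set V) (hA : N.IsCut A) : (N.contractionMatrix T).rank ≤ N.cutValue A := by
  have hcut : ∀ e : N.G.edgeSet, ∀ v w, v ∈ (e : Sym2 V) → w ∈ (e : Sym2 V) → v ∈ A → w ∉ A →
      e ∈ N.cutSet A := fun e v w hv hw hvA hwA =>
    ⟨v, hvA, w, hwA, (Sym2.mem_and_mem_iff (show v ≠ w from fun h => hwA (h ▸ hvA))).1 ⟨hv, hw⟩⟩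
  let val : N.Labeling → N.Inner → ℂ := fun x u => (N.stdBasis u.1).repr (T u) (x.at u.1)
  let g : N.Index N.s → N.Labeling → ℂ := fun i x =>
    if x.at N.s = i then ∏ u with u.1 ∈ A, val x u else 0
  let h : N.Index N.t → N.Labeling → ℂ := fun j x =>
    if x.at N.t = j then ∏ u with ¬ u.1 ∈ A, val x u else 0
  have hat : ∀ (x x' : N.Labeling) v, (∀ e : N.G.edgeSet, v ∈ (e : Sym2 V) → x e = x' e) →
      x.at v = x'.at v := fun x x' v hx => funext fun e => hx e.1 e.2
  have hg : ∀ i x x', (∀ e : N.G.edgeSet, ∀ v ∈ A, v ∈ (e : Sym2 V) → x e = x' e) →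
      g i x = g i x' := fun i x x' hx => by
    simp only [g, val]
    rw [hat x x' N.s fun e he => hx e _ hA.1 he]
    congr 1
    refine Finset.prod_congr rfl fun u hu => ?_
    rw [hat x x' u.1 fun e he => hx e _ (Finset.mem_filter.1 hu).2 he]
  have hh : ∀ j x x', (∀ e : N.G.edgeSet, ∀ v ∉ A, v ∈ (e : Sym2 V) → x e = x' e) →
      h j x = h j x' := fun j x x' hx => by
    simp only [h, val]
    rw [hat x x' N.t fun e he => hx e _ hA.2 he]
    congr 1
    refine Finset.prod_congr rfl fun u hu => ?_
    rw [hat x x' u.1 fun e he => hx e _ (Finset.mem_filter.1 hu).2 he]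
  have hM : ∀ i j, N.contractionMatrix T j i = ∑ x, h j x * g i x := fun i j => by
    simp only [contractionMatrix, g, h]
    rw [Finset.sum_filter]
    refine Finset.sum_congr rfl fun x _ => ?_
    by_cases h1 : x.at N.s = i <;> by_cases h2 : x.at N.t = j <;> simp only [h1, h2, and_true,
      and_false, if_true, if_false, mul_zero, zero_mul]
    rw [mul_comm]
    exact (Finset.prod_filter_mul_prod_filter_not _ _ _).symm
  -- A labeling splits into the cut edges, the other edges meeting `A`, and the edges missing `A`.
  let join : (∀ e : {e // e ∈ N.cutSet A}, Fin (N.d e.1)) ×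
      ((∀ e : {e : {e // e ∉ N.cutSet A} // ∃ v ∈ A, v ∈ (e.1 : Sym2 V)}, Fin (N.d e.1.1)) ×
      (∀ e : {e : {e // e ∉ N.cutSet A} // ¬∃ v ∈ A, v ∈ (e.1 : Sym2 V)}, Fin (N.d e.1.1))) ≃
      N.Labeling :=
    ((Equiv.piEquivPiSubtypeProd (fun e => e ∈ N.cutSet A) fun e => Fin (N.d e)).trans
      (Equiv.prodCongr (Equiv.refl _) (Equiv.piEquivPiSubtypeProd
        (fun e : {e // e ∉ N.cutSet A} => ∃ v ∈ A, v ∈ (e.1 : Sym2 V))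
        fun e => Fin (N.d e.1)))).symm
  have hjoin : ∀ y a b e, join (y, a, b) e = if h : e ∈ N.cutSet A then y ⟨e, h⟩ else
      if h' : ∃ v ∈ A, v ∈ (e : Sym2 V) then a ⟨⟨e, h⟩, h'⟩ else b ⟨⟨e, h⟩, h'⟩ :=
    fun y a b e => rfl
  clear_value g h join
  -- Filler label: `h` ignores non-cut edges meeting `A`, and `g` ignores edges missing `A`.
  let z : ∀ e, Fin (N.d e) := fun e => ⟨0, two_pos.trans_le (N.two_le_d e)⟩
  have hfac : N.contractionMatrix T =
      (Matrix.of fun j y => ∑ b, h j (join (y, (fun e => z e.1.1), b))) *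
      (Matrix.of fun y i => ∑ a, g i (join (y, a, fun e => z e.1.1))) := by
    ext j i
    rw [hM, Matrix.mul_apply, ← join.sum_comp, Fintype.sum_prod_type]
    refine Finset.sum_congr rfl fun y _ => ?_
    rw [Fintype.sum_prod_type, Matrix.of_apply, Matrix.of_apply, Finset.sum_mul_sum,
      Finset.sum_comm]
    refine Finset.sum_congr rfl fun b _ => Finset.sum_congr rfl fun a _ => ?_
    refine congrArg₂ (· * ·) ?_ ?_
    · refine hh _ _ _ fun e v hv hve => ?_
      rw [hjoin, hjoin]
      split_ifs with h1 h2
      · rfl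
      · obtain ⟨w, hw, hwe⟩ := h2
        exact absurd (hcut e w v hwe hve hw hv) h1
      · rfl
    · refine hg _ _ _ fun e v hv hve => ?_
      rw [hjoin, hjoin]
      split_ifs with h1 h2
      · rfl
      · rfl
      · exact absurd ⟨v, hv, hve⟩ h2
  rw [hfac]
  refine (Matrix.rank_mul_le_left _ _).trans ((Matrix.rank_le_card_width _).trans (le_of_eq ?_))
  rw [Fintype.card_pi, cutValue]
  simp only [Fintype.card_fin]
  exact (Finset.prod_subtype (p := fun e => e ∈ N.cutSet A) _ (by simp) N.d).symm

theorem maxFlow_le_minCut [Fintype V] (N : TensorNetwork V) : N.maxFlow ≤ N.minCut := by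
  obtain ⟨T, hT⟩ := N.maxFlow_isGreatest.1
  obtain ⟨A, hA, hcut⟩ := N.minCut_isLeast.1
  rw [← hT, ← hcut, contractionRank_eq_rank]
  exact N.rank_contractionMatrix_le_cutValue T A hA

end TensorNetwork

/-! ### Lexicographic capacities -/

/-- The group of pairs `(a, q)` of an integer and a positive rational, ordered lexicographically;
`(a, q)` stands for the quantity `n ^ a * q` with `n` arbitrarily large. -/
abbrev LexCapacity : Type := ℤ ×ₗ Additive {q : ℚ // 0 < q}

/-- The value of `n ^ a * q` at a positive integer `n`. -/
def lexEval (n : ℕ+) : Multiplicative LexCapacity →* ℚ where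
  toFun x := ((n : ℕ) : ℚ) ^ (ofLex x.toAdd).1 * ((ofLex x.toAdd).2.toMul : ℚ)
  map_one' := by
    change ((n : ℕ) : ℚ) ^ (0 : ℤ) * 1 = 1
    simp
  map_mul' x y := by
    have hn : ((n : ℕ) : ℚ) ≠ 0 := by exact_mod_cast n.ne_zero
    change ((n : ℕ) : ℚ) ^ ((ofLex x.toAdd).1 + (ofLex y.toAdd).1) *
      (((ofLex x.toAdd).2.toMul : ℚ) * ((ofLex y.toAdd).2.toMul : ℚ)) = _
    rw [zpow_add₀ hn]
    ring

theorem lexEval_apply (n : ℕ+) (a : ℤ) (q : {q : ℚ // 0 < q}) :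
    lexEval n (Multiplicative.ofAdd (toLex (a, Additive.ofMul q))) = ((n : ℕ) : ℚ) ^ a * q :=
  rfl

theorem lexEval_pos (n : ℕ+) (x : Multiplicative LexCapacity) : 0 < lexEval n x :=
  mul_pos (zpow_pos (by exact_mod_cast n.pos) _) (ofLex x.toAdd).2.toMul.2

theorem ratWeight_natCast_mul {q : ℚ} (hq : 0 < q) {n : ℕ} (h : q.den ∣ n) :
    (ratWeight (n * q) : ℚ) = n * q := by
  obtain ⟨k, rfl⟩ := h
  have h1 : ((q.den * k : ℕ) : ℚ) * q = ((k * q.num.natAbs : ℕ) : ℚ) := by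
    have h2 : ((q.num.natAbs : ℕ) : ℚ) = q.num := by
      rw [← Int.cast_natCast, Int.natAbs_of_nonneg (Rat.num_nonneg.2 hq.le)]
    rw [Nat.cast_mul, Nat.cast_mul, h2, ← Rat.den_mul_eq_num]
    ring
  rw [h1, ratWeight, Rat.num_natCast, Rat.den_natCast, Int.natAbs_natCast, mul_one]

theorem den_dvd_ratWeight (q : ℚ) : q.den ∣ ratWeight q := dvd_mul_left _ _

/-- The capacity that stands for the dimension `n * d`. -/
def edgeCapacity (d : ℕ) (hd : 2 ≤ d) : LexCapacity :=
  toLex (1, Additive.ofMul ⟨d, by exact_mod_cast two_pos.trans_le hd⟩)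

theorem lexEval_edgeCapacity (n : ℕ+) (d : ℕ) (hd : 2 ≤ d) :
    lexEval n (Multiplicative.ofAdd (edgeCapacity d hd)) = ((n * d : ℕ) : ℚ) := by
  rw [edgeCapacity, lexEval_apply, zpow_one, Nat.cast_mul]

theorem edgeCapacity_nonneg (d : ℕ) (hd : 2 ≤ d) : 0 ≤ edgeCapacity d hd :=
  Prod.Lex.toLex_le_toLex.2 (Or.inl zero_lt_one)

/-- A lexicographic flow value within the capacity becomes, for suitable `n`, a rational whose
numerator and denominator fit together into dimension `n * d`. -/
theorem ratWeight_lexEval_le {d : ℕ} (hd : 2 ≤ d) {x : LexCapacity}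
    (h1 : -edgeCapacity d hd ≤ x) (h2 : x ≤ edgeCapacity d hd) (n : ℕ+)
    (hn : ratWeight ((ofLex x).2.toMul : ℚ) ∣ n) :
    ratWeight (lexEval n (Multiplicative.ofAdd x)) ≤ n * d := by
  obtain ⟨⟨a, q⟩, rfl⟩ := toLex.surjective x
  obtain ⟨⟨q, hq⟩, rfl⟩ := Additive.ofMul.surjective q
  have hn0 : (0 : ℚ) < (n : ℕ) := by exact_mod_cast n.pos
  have hd0 : (0 : ℚ) < d := by exact_mod_cast two_pos.trans_le hd
  change ratWeight q ∣ n at hn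
  rw [lexEval_apply]
  -- The lexicographic bounds force `a` to be `-1`, `0` or `1`, with `q` constrained only when `a`
  -- is `-1` or `1`.
  have h1' : (-1 : ℤ) < a ∨ (-1 : ℤ) = a ∧ (d : ℚ)⁻¹ ≤ q := Prod.Lex.toLex_le_toLex.1 h1
  have h2' : a < 1 ∨ a = 1 ∧ q ≤ d := Prod.Lex.toLex_le_toLex.1 h2
  change ratWeight ((n : ℕ) ^ a * q) ≤ n * d
  rcases h2' with h2' | ⟨rfl, h2'⟩
  · rcases h1' with h1' | ⟨rfl, h1'⟩
    · obtain rfl : a = 0 := by omega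
      rw [zpow_zero, one_mul]
      exact (Nat.le_of_dvd n.pos hn).trans (Nat.le_mul_of_pos_right _ (two_pos.trans_le hd))
    · rw [← ratWeight_inv, mul_inv, zpow_neg, zpow_one, inv_inv]
      rw [← ratWeight_inv] at hn
      have h3 := ratWeight_natCast_mul (inv_pos.2 hq) ((den_dvd_ratWeight _).trans hn)
      have h4 : q⁻¹ ≤ d := inv_le_of_inv_le₀ hd0 h1'
      exact_mod_cast h3.le.trans (mul_le_mul_of_nonneg_left h4 hn0.le)
  · rw [zpow_one]
    have h3 := ratWeight_natCast_mul hq ((den_dvd_ratWeight _).trans hn)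
    exact_mod_cast h3.le.trans (mul_le_mul_of_nonneg_left h2' hn0.le)

/-! ### The lexicographic flow of a network and the conclusion -/

namespace TensorNetwork

variable {V : Type*}

theorem mem_cutSet_iff (N : TensorNetwork V) {src tgt : N.G.edgeSet → V}
    (h : ∀ e : N.G.edgeSet, (e : Sym2 V) = s(src e, tgt e)) (A : Set V) (e : N.G.edgeSet) :
    e ∈ N.cutSet A ↔ ¬(src e ∈ A ↔ tgt e ∈ A) := by
  change (∃ v ∈ A, ∃ w ∉ A, (e : Sym2 V) = s(v, w)) ↔ _
  rw [h e]
  constructor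
  · rintro ⟨v, hv, w, hw, hvw⟩
    rcases Sym2.eq_iff.1 hvw with ⟨h1, h2⟩ | ⟨h1, h2⟩ <;> simp [h1, h2, hv, hw]
  · intro h'
    by_cases h1 : src e ∈ A
    · exact ⟨_, h1, tgt e, fun h2 => h' (by simp [h1, h2]), rfl⟩
    · exact ⟨tgt e, by by_contra h2; exact h' (by simp [h1, h2]), _, h1, Sym2.eq_swap⟩

theorem exists_orientation (N : TensorNetwork V) :
    ∃ src tgt : N.G.edgeSet → V, ∀ e : N.G.edgeSet, (e : Sym2 V) = s(src e, tgt e) := by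
  have : ∀ e : N.G.edgeSet, ∃ p : V × V, (e : Sym2 V) = s(p.1, p.2) := fun e => by
    obtain ⟨p, hp⟩ := Sym2.mk_surjective e.1
    exact ⟨p, hp.symm⟩
  choose p hp using this
  exact ⟨fun e => (p e).1, fun e => (p e).2, hp⟩

/-- The lexicographic capacity of an edge. -/
def lexCapacity (N : TensorNetwork V) (e : N.G.edgeSet) : LexCapacity :=
  edgeCapacity (N.d e) (N.two_le_d e)

open Classical in
/-- A lexicographic maximum flow together with a minimum cut. -/
theorem exists_lex_flow [Fintype V] (N : TensorNetwork V) {src tgt : N.G.edgeSet → V}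
    (h : ∀ e : N.G.edgeSet, (e : Sym2 V) = s(src e, tgt e)) :
    ∃ (A : Set V) (f : N.G.edgeSet → LexCapacity), N.IsCut A ∧
      (∀ e, -N.lexCapacity e ≤ f e ∧ f e ≤ N.lexCapacity e) ∧
      ∀ B, ∑ e, cutSign B (src e) (tgt e) • f e =
        cutSign B N.s N.t • ∑ e with e ∈ N.cutSet A, N.lexCapacity e := by
  have hpos : ∀ e, 0 ≤ N.lexCapacity e := fun e => edgeCapacity_nonneg _ _
  obtain ⟨A, hA, hmin⟩ := Set.exists_min_image {A | N.IsCut A}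
    (fun A => ∑ e with e ∈ N.cutSet A, N.lexCapacity e) (Set.toFinite _)
    ⟨{N.s}, rfl, fun h => N.s_ne_t h.symm⟩
  obtain ⟨f, hf, hf'⟩ := exists_flow_of_le_cuts src tgt N.s N.t (fun e => -N.lexCapacity e)
    N.lexCapacity (fun e => neg_nonpos.2 (hpos e)) hpos
    (∑ e with e ∈ N.cutSet A, N.lexCapacity e) (Finset.sum_nonneg fun e _ => hpos e)
    (fun B hs ht => (hmin B ⟨hs, ht⟩).trans (le_of_eq (by
      rw [Finset.sum_filter]
      refine Finset.sum_congr rfl fun e _ => ?_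
      by_cases h1 : src e ∈ B <;> by_cases h2 : tgt e ∈ B <;>
        simp [outCapacity, N.mem_cutSet_iff h, h1, h2])))
  exact ⟨A, f, hA, hf, hf'⟩

/-- The quantum max-flow of `nN` attains the quantum min-cut for all multiples `n` of a suitable
positive integer. -/
theorem exists_forall_maxFlow_scale_eq [Fintype V] (N : TensorNetwork V) :
    ∃ M : ℕ+, ∀ n : ℕ+, M ∣ n → (N.scale n).maxFlow = (N.scale n).minCut := by
  classical
  obtain ⟨src, tgt, h⟩ := N.exists_orientation
  obtain ⟨A, f, hA, hf, hflow⟩ := N.exists_lex_flow h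
  let w : N.G.edgeSet → ℚ := fun e => ((ofLex (f e)).2.toMul : ℚ)
  have hw : ∀ e, 0 < ratWeight (w e) := fun e => ratWeight_pos (ofLex (f e)).2.toMul.2
  refine ⟨⟨∏ e, ratWeight (w e), Finset.prod_pos fun e _ => hw e⟩, fun n hn => ?_⟩
  have hdvd : ∀ e, ratWeight (w e) ∣ n := fun e =>
    (Finset.dvd_prod_of_mem _ (Finset.mem_univ e)).trans (PNat.dvd_iff.1 hn)
  refine le_antisymm (N.scale n).maxFlow_le_minCut ?_
  have hval : lexEval n (Multiplicative.ofAdd (∑ e with e ∈ N.cutSet A, N.lexCapacity e)) =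
      ((N.scale n).cutValue A : ℚ) := by
    rw [ofAdd_sum, map_prod]
    simp only [lexCapacity, lexEval_edgeCapacity]
    rw [← Nat.cast_prod]
    rfl
  obtain ⟨ι, _, m, C, hm, hC, hle⟩ := exists_weighted_connecting_family src tgt N.s N.t
    ((N.scale n).cutValue A) (fun e => lexEval n (Multiplicative.ofAdd (f e)))
    (Finset.prod_pos fun e _ => two_pos.trans_le ((N.scale n).two_le_d e))
    (fun e => lexEval_pos n _)
    (fun B => by
      rw [← hval, ← map_zpow, ← ofAdd_zsmul, ← hflow, ofAdd_sum, map_prod]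
      simp only [ofAdd_zsmul, map_zpow])
  calc (N.scale n).minCut ≤ (N.scale n).cutValue A := (N.scale n).minCut_isLeast.2 ⟨A, hA, rfl⟩
    _ = ∏ i, m i := hm.symm
    _ ≤ (N.scale n).maxFlow := (N.scale n).prod_le_maxFlow m C
        (fun i B hB => by
          obtain ⟨e, he, hB'⟩ := hC i B hB.1 hB.2
          exact ⟨e, he, (N.mem_cutSet_iff h B e).2 hB'⟩)
        (fun e => (hle e).trans
          (ratWeight_lexEval_le (N.two_le_d e) (hf e).1 (hf e).2 n (hdvd e)))

end TensorNetwork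

/-- For every quantum tensor network `N` there are infinitely many positive integers `n` such that
the quantum max-flow of `nN` equals the quantum min-cut of `nN`. -/
theorem mainTheorem1 {V : Type*} [Fintype V] (N : TensorNetwork V) :
    {n : ℕ+ | (N.scale n).maxFlow = (N.scale n).minCut}.Infinite := by
  obtain ⟨M, hM⟩ := N.exists_forall_maxFlow_scale_eq
  exact Set.infinite_of_injective_forall_mem (f := fun k : ℕ+ => M * k)
    (mul_right_injective M) fun k => hM _ (dvd_mul_right M k)
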